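/- Let $d \ge 2$, and let $|\cdot|$ be the Euclidean norm on $\mathbb R^d$. For $E \subseteq \mathbb R^d$ let $\Delta(E) = \{|x-y| : x, y \in E\}$ be its distance set; $E$ has the Steinhaus property if $\Delta(E) \supseteq [0,a)$ for some $a > 0$. For an integer $q \ge 2$ and a real $\sigma > 1$, put $E_0 = [0,1]^d$, $$E_{n+1} = \bigcup_{p \in \{0,\dots,q-1\}^d} \Bigl( \frac pq + q^{-\sigma} E_n \Bigr) \quad (n \ge 0), \qquad E^*[q;\sigma] = \bigcap_{n \ge 1} E_n .$$ There exist $\varepsilon > 0$ and $r > 1$, depending only on $d$, such that the following holds for every real $s \in (d-\varepsilon, d)$. (i) There is a compact, totally disconnected set $K \subseteq \mathbb R^d$ of Hausdorff dimension $s$ that has the Steinhaus property. (ii) Such a set can be built from finitely many copies of a self-similar set: let $\sigma = d/s$, let $q$ be any integer with $q \ge 2$ and $q^\sigma > r$, and let $m$ be the largest integer with $q^\sigma > r^m$. Then there exist $x_0, \dots, x_m \in \mathbb R^d$ and $u_0, \dots, u_m > 0$ such that the sets $x_k + u_k E^*[q;\sigma]$, $0 \le k \le m$, are pairwise disjoint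 and their union $$K^* = \bigsqcup_{k=0}^m \bigl(x_k + u_k E^*[q;\sigma]\bigr)$$ is compact and totally disconnected, has Hausdorff dimension $s$, and has the Steinhaus property. -/

import Mathlib

noncomputable section

/-- The distance set `Δ(E)`: all Euclidean distances `|x - y|` with `x, y ∈ E`. -/
def distanceSet {d : ℕ} (E : Set (EuclideanSpace ℝ (Fin d))) : Set ℝ :=
  {t | ∃ x ∈ E, ∃ y ∈ E, t = dist x y}

/-- The unit cube `[0,1]^d`. -/
def unitCube (d : ℕ) : Set (EuclideanSpace ℝ (Fin d)) :=
  {x | ∀ i, 0 ≤ x i ∧ x i ≤ 1}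

/-- The grid point `p / q`, for `p ∈ {0, …, q - 1}^d`. -/
def gridPoint {d q : ℕ} (p : Fin d → Fin q) : EuclideanSpace ℝ (Fin d) :=
  WithLp.toLp 2 (fun i => ((p i : ℕ) : ℝ) / (q : ℝ))

/-- The affine copy `x + u A` of a set `A`. -/
def affineCopy {d : ℕ} (x : EuclideanSpace ℝ (Fin d)) (u : ℝ)
    (A : Set (EuclideanSpace ℝ (Fin d))) : Set (EuclideanSpace ℝ (Fin d)) :=
  (fun y => x + u • y) '' A

/-- The iterates: stage `0` is `[0,1]^d`, and stage `n + 1` is the union over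
`p ∈ {0, …, q - 1}^d` of the copies `p / q + q ^ (-σ) E_n` of stage `n`.
In particular stage `1` is the union of the cubes `p / q + q ^ (-σ) [0,1]^d`. -/
def falconerStage (d q : ℕ) (σ : ℝ) : ℕ → Set (EuclideanSpace ℝ (Fin d))
  | 0 => unitCube d
  | n + 1 => ⋃ p : Fin d → Fin q,
      affineCopy (gridPoint p) ((q : ℝ) ^ (-σ)) (falconerStage d q σ n)

/-- The self-similar Falconer-type set `E*[q; σ] = ⋂_{n ≥ 1} E_n`. -/
def falconerSet (d q : ℕ) (σ : ℝ) : Set (EuclideanSpace ℝ (Fin d)) :=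
  ⋂ n : ℕ, falconerStage d q σ (n + 1)

/-- The Steinhaus property: `Δ(E)` contains `[0, a)` for some `a > 0`. -/
def HasSteinhausProperty {d : ℕ} (E : Set (EuclideanSpace ℝ (Fin d))) : Prop :=
  ∃ a : ℝ, 0 < a ∧ Set.Ico 0 a ⊆ distanceSet E

end

/-!
Write `l = q ^ (-σ)`. The differences of two points of `E*[q; σ]` include all vectors whose
coordinates are signed digit sums `∑ (b k / q) l ^ k`, `|b k| < q`, so `E*[q; σ]` realizes every
distance that can be approximated by `√(X ^ 2 + Y ^ 2)` with `X`, `Y` such sums. For `s` close to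
`d`, that is, `σ` close to `1`, there are two cases. Either `l q ≥ 3 / 4`, and the signed digit sums
alone are dense in an interval around `0`; or `q (l q) ^ 2` is large, and `t ^ 2` can be expanded
greedily as `X ^ 2 + Y ^ 2`. Here `X` is raised first, while a reserve is kept for `Y`. This forces
`2 / q ≤ Y ≤ l q / 20`: the lower bound keeps the digits of `Y` below `q`, and the upper bound makes
the residual, about `2 Y l ^ n / q`, of order `l ^ (n + 1)`. In both cases every distance in
`[1 / 8, 1 / 2]` occurs. Since `l E*[q; σ] ⊆ E*[q; σ]`, so do all `l ^ n t` with `t` in this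
interval, and the copies with ratios `4 ^ (-k)`, `k ≤ m`, fill the gaps between these scales because
`4 ^ (-(m + 1)) ≤ l`.

Reading the digits of a point of `E*[q; σ]` in base `q` gives a Hölder map of exponent `1 / σ` from
a subset of `E*[q; σ]` onto the unit cube, which bounds the dimension below by `d / σ = s`; covering
by the cubes of the `n`-th stage bounds it above. Each coordinate of a point of `E*[q; σ]` lies in a
set of dimension `1 / σ < 1`, and sets of dimension less than `1` are totally disconnected.
-/

open Set Filter MeasureTheory Metric
open scoped ENNReal NNReal Topology

/-! ### Hausdorff dimension and total disconnectedness -/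

theorem dimH_range_le_of_edist_le {α X Y : Type*} [EMetricSpace X] [EMetricSpace Y] {C r : ℝ≥0}
    (hr : 0 < r) {f : α → X} {g : α → Y}
    (h : ∀ a b, edist (g a) (g b) ≤ C * edist (f a) (f b) ^ (r : ℝ)) :
    dimH (range g) ≤ dimH (range f) / r := by
  have hfac : g.FactorsThrough f := fun a b hab => by
    simpa [hab, NNReal.coe_pos.2 hr] using h a b
  rcases isEmpty_or_nonempty α with _ | ⟨⟨a₀⟩⟩
  · simp [range_eq_empty]
  set φ := Function.extend f g fun _ => g a₀
  have hφ : ∀ a, φ (f a) = g a := hfac.extend_apply _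
  have hholder : HolderOnWith C r φ (range f) := by
    rintro _ ⟨a, rfl⟩ _ ⟨b, rfl⟩
    simpa only [hφ] using h a b
  have himage : φ '' range f = range g := by
    rw [← range_comp]
    exact congrArg range (funext hφ)
  exact himage ▸ hholder.dimH_image_le hr

theorem dimH_Icc_zero_one_pi (d : ℕ) : dimH (Icc (0 : Fin d → ℝ) 1) = d := by
  have hint : (interior (Icc (0 : Fin d → ℝ) 1)).Nonempty := by
    rw [← pi_univ_Icc, interior_pi_set finite_univ]
    exact ⟨fun _ => 1 / 2, fun i _ => by norm_num [interior_Icc]⟩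
  rw [Real.dimH_of_nonempty_interior hint, Module.finrank_fin_fun]

theorem isTotallyDisconnected_of_dimH_lt_one {X : Type*} [MetricSpace X] {s : Set X}
    (hs : dimH s < 1) : IsTotallyDisconnected s := by
  intro S hSs hS x hx y hy
  by_contra hxy
  have hsub : Icc 0 (dist x y) ⊆ dist x '' S :=
    (hS.image (dist x) (by fun_prop)).Icc_subset ⟨x, hx, dist_self x⟩ ⟨y, hy, rfl⟩
  have hone : dimH (Icc 0 (dist x y)) = 1 := by
    rw [Real.dimH_of_nonempty_interior (by simpa [interior_Icc] using hxy)]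
    simp
  have : (1 : ℝ≥0∞) ≤ dimH s :=
    calc 1 = dimH (Icc 0 (dist x y)) := hone.symm
      _ ≤ dimH (dist x '' S) := dimH_mono hsub
      _ ≤ dimH S := (LipschitzWith.dist_right x).dimH_image_le S
      _ ≤ dimH s := dimH_mono hSs
  exact this.not_gt hs

theorem isTotallyDisconnected_of_forall_image {X ι : Type*} {Y : ι → Type*} [TopologicalSpace X]
    [∀ i, TopologicalSpace (Y i)] {s : Set X} {f : ∀ i, X → Y i} (hf : ∀ i, Continuous (f i))
    (hinj : ∀ x y, (∀ i, f i x = f i y) → x = y) (h : ∀ i, IsTotallyDisconnected (f i '' s)) :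
    IsTotallyDisconnected s := fun S hSs hS x hx y hy =>
  hinj x y fun i => h i (f i '' S) (image_mono hSs) (hS.image _ (hf i).continuousOn)
    (mem_image_of_mem _ hx) (mem_image_of_mem _ hy)

/-! ### Distance sets and affine copies -/

section AffineCopy

variable {d : ℕ} {A B : Set (EuclideanSpace ℝ (Fin d))} {t u : ℝ}

theorem distanceSet_mono (h : A ⊆ B) : distanceSet A ⊆ distanceSet B :=
  fun _ ⟨x, hx, y, hy, ht⟩ => ⟨x, h hx, y, h hy, ht⟩

theorem isCompact_distanceSet (hA : IsCompact A) : IsCompact (distanceSet A) := by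
  have : distanceSet A = (fun p => dist p.1 p.2) '' (A ×ˢ A) := by
    ext t
    simp only [distanceSet, mem_ofPred_eq, mem_image, Prod.exists, mem_prod, eq_comm, and_assoc,
      exists_and_left]
  exact this ▸ (hA.prod hA).image continuous_dist

theorem mem_distanceSet_of_sq_approx (hA : IsCompact A) (ht : 0 ≤ t)
    (h : ∀ ε > 0, ∃ u ∈ distanceSet A, |u ^ 2 - t ^ 2| < ε) : t ∈ distanceSet A := by
  have hclosed : IsClosed ((· ^ 2) '' distanceSet A) :=
    ((isCompact_distanceSet hA).image (continuous_pow 2)).isClosed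
  have hmem : t ^ 2 ∈ (· ^ 2) '' distanceSet A := hclosed.closure_subset <|
    Metric.mem_closure_iff.2 fun ε hε => by
      obtain ⟨u, hu, hut⟩ := h ε hε
      exact ⟨_, mem_image_of_mem _ hu, by rwa [dist_comm, Real.dist_eq]⟩
  obtain ⟨_, ⟨x, hx, y, hy, rfl⟩, hsq⟩ := hmem
  exact ⟨x, hx, y, hy, ((pow_left_inj₀ dist_nonneg ht two_ne_zero).1 hsq).symm⟩

theorem mul_mem_distanceSet_affineCopy (ht : t ∈ distanceSet A) (hu : 0 ≤ u)
    (x : EuclideanSpace ℝ (Fin d)) : u * t ∈ distanceSet (affineCopy x u A) := by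
  obtain ⟨y, hy, z, hz, rfl⟩ := ht
  refine ⟨_, mem_image_of_mem _ hy, _, mem_image_of_mem _ hz, ?_⟩
  rw [dist_add_left, dist_smul₀, Real.norm_of_nonneg hu]

theorem isCompact_affineCopy (x : EuclideanSpace ℝ (Fin d)) (u : ℝ) (hA : IsCompact A) :
    IsCompact (affineCopy x u A) :=
  hA.image (by fun_prop)

theorem ediam_affineCopy_le (x : EuclideanSpace ℝ (Fin d)) (hu : 0 ≤ u)
    (A : Set (EuclideanSpace ℝ (Fin d))) :
    ediam (affineCopy x u A) ≤ ENNReal.ofReal u * ediam A := by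
  have h : LipschitzWith u.toNNReal fun y : EuclideanSpace ℝ (Fin d) => x + u • y := by
    refine LipschitzWith.of_dist_le_mul fun y z => ?_
    rw [dist_add_left, dist_smul₀, Real.norm_of_nonneg hu, Real.coe_toNNReal _ hu]
  exact h.ediam_image_le A

theorem dimH_affineCopy (x : EuclideanSpace ℝ (Fin d)) (hu : u ≠ 0)
    (A : Set (EuclideanSpace ℝ (Fin d))) : dimH (affineCopy x u A) = dimH A := by
  have h : affineCopy x u A = IsometryEquiv.addLeft x ''
      ((ContinuousLinearEquiv.smulLeft (Units.mk0 u hu) :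
        EuclideanSpace ℝ (Fin d) ≃L[ℝ] EuclideanSpace ℝ (Fin d)) '' A) := by
    rw [image_image]
    rfl
  rw [h, IsometryEquiv.dimH_image, ContinuousLinearEquiv.dimH_image]

theorem dimH_iUnion_affineCopy {ι : Type*} [Countable ι] [Nonempty ι]
    (x : ι → EuclideanSpace ℝ (Fin d)) {u : ι → ℝ} (hu : ∀ k, u k ≠ 0)
    (A : Set (EuclideanSpace ℝ (Fin d))) : dimH (⋃ k, affineCopy (x k) (u k) A) = dimH A := by
  simp only [dimH_iUnion, dimH_affineCopy _ (hu _), ciSup_const]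

theorem pairwise_disjoint_affineCopy {ι : Type*} (hA : A ⊆ unitCube d)
    {x : ι → EuclideanSpace ℝ (Fin d)} {u : ι → ℝ} (hu : ∀ k, u k ∈ Icc (0 : ℝ) 1) (i : Fin d)
    (hx : Pairwise fun j k => 1 < |x j i - x k i|) :
    Pairwise fun j k => Disjoint (affineCopy (x j) (u j) A) (affineCopy (x k) (u k) A) := by
  have hcoord : ∀ k, ∀ y ∈ affineCopy (x k) (u k) A, y i - x k i ∈ Icc (0 : ℝ) 1 := by
    rintro k _ ⟨z, hz, rfl⟩
    simpa using unitInterval.mul_mem (hu k) (hA hz i)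
  refine fun j k hjk => disjoint_left.2 fun y hyj hyk => (hx hjk).not_ge ?_
  obtain ⟨hj0, hj1⟩ := hcoord j y hyj
  obtain ⟨hk0, hk1⟩ := hcoord k y hyk
  exact abs_le.2 ⟨by linarith, by linarith⟩

end AffineCopy

/-! ### Cantor sums -/

/-- The value `∑ (a k / q) l ^ k` of a digit sequence `a` in base `l⁻¹`. For `l = q ^ (-σ)` these
are the points of the one-dimensional Falconer set. -/
noncomputable def cantorSum {q : ℕ} (l : ℝ) (a : ℕ → Fin q) : ℝ :=
  ∑' k, ((a k : ℕ) : ℝ) / q * l ^ k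

theorem digit_div_le {q : ℕ} (c : Fin q) : ((c : ℕ) : ℝ) / q ≤ 1 - 1 / q := by
  have hq : (0 : ℝ) < q := by exact_mod_cast Fin.pos c
  have h : ((c : ℕ) : ℝ) + 1 ≤ q := by exact_mod_cast c.isLt
  rw [div_le_iff₀ hq, sub_mul, one_div_mul_cancel hq.ne']
  linarith

theorem one_div_sub_le_abs_digit_add_mul_sub {q : ℕ} {l x y : ℝ} (hl : 0 ≤ l) {a b : Fin q}
    (hab : a ≠ b) (hx : x ∈ Icc (0 : ℝ) 1) (hy : y ∈ Icc (0 : ℝ) 1) :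
    1 / q - l ≤ |((a : ℕ) / q + l * x) - ((b : ℕ) / q + l * y)| := by
  wlog hlt : b < a generalizing a b x y
  · rw [abs_sub_comm]
    exact this hab.symm hy hx (hab.lt_of_le (not_lt.1 hlt))
  have hdigit : ((b : ℕ) : ℝ) / q + 1 / q ≤ (a : ℕ) / q := by
    rw [← add_div]
    gcongr
    exact_mod_cast hlt
  have hlx := mul_nonneg hl hx.1
  have hly := mul_le_of_le_one_right hl hy.2
  exact le_abs.2 (Or.inl (by linarith))

section CantorSum

variable {q : ℕ} {l : ℝ} (h0 : 0 ≤ l) (hl : l < 1 / q)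

include hl in
theorem lt_one_of_lt_one_div : l < 1 :=
  hl.trans_le ((one_div (q : ℝ)).trans_le (Nat.cast_inv_le_one q))

include h0 hl

theorem summable_cantorSum (a : ℕ → Fin q) : Summable fun k => ((a k : ℕ) : ℝ) / q * l ^ k := by
  refine Summable.of_nonneg_of_le (fun k => by positivity) (fun k => ?_)
    (summable_geometric_of_lt_one h0 (lt_one_of_lt_one_div hl))
  have hdigit := digit_div_le (a k)
  have : (0 : ℝ) ≤ 1 / q := by positivity
  exact mul_le_of_le_one_left (by positivity) (by linarith)

theorem cantorSum_eq_head_add (a : ℕ → Fin q) :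
    cantorSum l a = ((a 0 : ℕ) : ℝ) / q + l * cantorSum l (fun k => a (k + 1)) := by
  unfold cantorSum
  rw [(summable_cantorSum h0 hl a).tsum_eq_zero_add, ← tsum_mul_left]
  simp only [pow_zero, mul_one, pow_succ', mul_left_comm]

theorem cantorSum_mem_Icc (a : ℕ → Fin q) : cantorSum l a ∈ Icc (0 : ℝ) 1 := by
  have hl1 := lt_one_of_lt_one_div hl
  refine ⟨tsum_nonneg fun _ => by positivity, ?_⟩
  calc cantorSum l a ≤ ∑' k, (1 - 1 / (q : ℝ)) * l ^ k :=
        (summable_cantorSum h0 hl a).tsum_le_tsum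
          (fun k => mul_le_mul_of_nonneg_right (digit_div_le (a k)) (by positivity))
          ((summable_geometric_of_lt_one h0 hl1).mul_left _)
    _ = (1 - 1 / q) / (1 - l) := by
        rw [tsum_mul_left, tsum_geometric_of_lt_one h0 hl1, ← div_eq_mul_inv]
    _ ≤ 1 := (div_le_one (by linarith)).2 (by linarith)

theorem le_abs_cantorSum_sub (n : ℕ) (a b : ℕ → Fin q) (hab : ∀ k < n, a k = b k)
    (hn : a n ≠ b n) : (1 / q - l) * l ^ n ≤ |cantorSum l a - cantorSum l b| := by
  induction n generalizing a b with
  | zero =>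
    rw [pow_zero, mul_one, cantorSum_eq_head_add h0 hl a, cantorSum_eq_head_add h0 hl b]
    exact one_div_sub_le_abs_digit_add_mul_sub h0 hn (cantorSum_mem_Icc h0 hl _)
      (cantorSum_mem_Icc h0 hl _)
  | succ n ih =>
    have htail := ih (fun k => a (k + 1)) (fun k => b (k + 1)) (fun k hk => hab _ (by lia)) hn
    rw [cantorSum_eq_head_add h0 hl a, cantorSum_eq_head_add h0 hl b, hab 0 (by lia),
      add_sub_add_left_eq_sub, ← mul_sub, abs_mul, abs_of_nonneg h0, pow_succ', mul_left_comm]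
    exact mul_le_mul_of_nonneg_left htail h0

end CantorSum

/-! ### Falconer sets -/

theorem rpow_neg_lt_one_div {q : ℕ} {σ : ℝ} (hq : 1 < q) (hσ : 1 < σ) :
    (q : ℝ) ^ (-σ) < 1 / q := by
  rw [one_div, ← Real.rpow_neg_one]
  exact Real.rpow_lt_rpow_of_exponent_lt (by exact_mod_cast hq) (by linarith)

theorem isCompact_unitCube (d : ℕ) : IsCompact (unitCube d) := by
  have h : unitCube d = EuclideanSpace.equiv (Fin d) ℝ ⁻¹' Icc 0 1 := by
    ext x
    simp only [unitCube, mem_ofPred_eq, mem_preimage, mem_Icc, Pi.le_def, forall_and]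
    rfl
  rw [h]
  exact (EuclideanSpace.equiv (Fin d) ℝ).toHomeomorph.isCompact_preimage.2 isCompact_Icc

theorem isCompact_falconerStage (d q : ℕ) (σ : ℝ) (n : ℕ) : IsCompact (falconerStage d q σ n) := by
  induction n with
  | zero => exact isCompact_unitCube d
  | succ n ih => exact isCompact_iUnion fun p => isCompact_affineCopy _ _ ih

theorem isCompact_falconerSet (d q : ℕ) (σ : ℝ) : IsCompact (falconerSet d q σ) :=
  (isCompact_falconerStage d q σ 1).of_isClosed_subset
    (isClosed_iInter fun n => (isCompact_falconerStage d q σ (n + 1)).isClosed)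
    (iInter_subset _ 0)

section Falconer

variable {d q : ℕ} {σ : ℝ} (hq : 1 < q) (hσ : 1 < σ)
include hq hσ

theorem falconerStage_subset_unitCube (n : ℕ) : falconerStage d q σ n ⊆ unitCube d := by
  induction n with
  | zero => exact subset_rfl
  | succ n ih =>
    refine iUnion_subset fun p => ?_
    rintro _ ⟨y, hy, rfl⟩ i
    obtain ⟨hy0, hy1⟩ := ih hy i
    have hl : (0 : ℝ) ≤ (q : ℝ) ^ (-σ) := by positivity
    simp only [gridPoint, PiLp.add_apply, PiLp.smul_apply, smul_eq_mul]
    refine ⟨by positivity, ?_⟩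
    linarith [digit_div_le (p i), mul_le_of_le_one_right hl hy1, rpow_neg_lt_one_div hq hσ]

theorem falconerSet_subset_unitCube : falconerSet d q σ ⊆ unitCube d :=
  (iInter_subset _ 0).trans (falconerStage_subset_unitCube hq hσ _)

theorem affineCopy_falconerSet_subset (p : Fin d → Fin q) :
    affineCopy (gridPoint p) ((q : ℝ) ^ (-σ)) (falconerSet d q σ) ⊆ falconerSet d q σ := by
  rintro _ ⟨y, hy, rfl⟩
  refine mem_iInter.2 fun n => mem_iUnion.2 ⟨p, mem_image_of_mem _ ?_⟩
  cases n with
  | zero => exact falconerSet_subset_unitCube hq hσ hy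
  | succ n => exact mem_iInter.1 hy n

theorem cantorSum_mem_falconerSet (a : Fin d → ℕ → Fin q) :
    WithLp.toLp 2 (fun i => cantorSum ((q : ℝ) ^ (-σ)) (a i)) ∈ falconerSet d q σ := by
  have h0 : (0 : ℝ) ≤ (q : ℝ) ^ (-σ) := by positivity
  have hl := rpow_neg_lt_one_div hq hσ
  refine mem_iInter.2 fun m => ?_
  induction m + 1 generalizing a with
  | zero => exact fun i => cantorSum_mem_Icc h0 hl _
  | succ n ih =>
    refine mem_iUnion.2 ⟨fun i => a i 0, _, ih fun i k => a i (k + 1), ?_⟩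
    ext i
    simp only [gridPoint, PiLp.add_apply, PiLp.smul_apply, smul_eq_mul]
    exact (cantorSum_eq_head_add h0 hl (a i)).symm

theorem falconerSet_nonempty : (falconerSet d q σ).Nonempty :=
  ⟨_, cantorSum_mem_falconerSet hq hσ fun _ _ => ⟨0, by lia⟩⟩

end Falconer

/-! ### Hausdorff dimension of Falconer sets -/

theorem exists_falconerStage_cover (d q : ℕ) (σ : ℝ) (n : ℕ) :
    ∃ C : (Fin n → Fin d → Fin q) → Set (EuclideanSpace ℝ (Fin d)),
      falconerStage d q σ n ⊆ ⋃ w, C w ∧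
        ∀ w, ediam (C w) ≤ ENNReal.ofReal ((q : ℝ) ^ (-σ)) ^ n * ediam (unitCube d) := by
  induction n with
  | zero => exact ⟨fun _ => unitCube d, fun x hx => mem_iUnion.2 ⟨Fin.elim0, hx⟩, by simp⟩
  | succ n ih =>
    obtain ⟨C, hcover, hdiam⟩ := ih
    refine ⟨fun w => affineCopy (gridPoint (w 0)) ((q : ℝ) ^ (-σ)) (C (Fin.tail w)),
      iUnion_subset fun p => ?_, fun w => ?_⟩
    · rintro _ ⟨y, hy, rfl⟩
      obtain ⟨w, hw⟩ := mem_iUnion.1 (hcover hy)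
      exact mem_iUnion.2 ⟨(Fin.cons p w : Fin (n + 1) → Fin d → Fin q), y, by simpa using hw,
        by simp⟩
    · refine (ediam_affineCopy_le _ (by positivity) _).trans ?_
      rw [pow_succ', mul_assoc]
      gcongr
      exact hdiam _

theorem pow_mul_ofReal_rpow_neg_rpow_div {q : ℕ} {σ : ℝ} (hq : 0 < q) (hσ : σ ≠ 0) (d : ℕ) :
    (q : ℝ≥0∞) ^ d * ENNReal.ofReal ((q : ℝ) ^ (-σ)) ^ (d / σ) = 1 := by
  have hq' : (0 : ℝ) < q := by exact_mod_cast hq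
  rw [ENNReal.ofReal_rpow_of_pos (by positivity), ← Real.rpow_mul hq'.le, neg_mul,
    mul_div_cancel₀ _ hσ, Real.rpow_neg hq'.le, Real.rpow_natCast,
    ENNReal.ofReal_inv_of_pos (by positivity), ENNReal.ofReal_pow hq'.le, ENNReal.ofReal_natCast]
  exact ENNReal.mul_inv_cancel (by simp [hq.ne']) (by simp)

theorem dimH_falconerSet_le {d q : ℕ} {σ : ℝ} (hq : 1 < q) (hσ : 0 < σ) :
    dimH (falconerSet d q σ) ≤ ENNReal.ofReal (d / σ) := by
  set L := ENNReal.ofReal ((q : ℝ) ^ (-σ))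
  set D := ediam (unitCube d)
  have hs : 0 ≤ d / σ := by positivity
  have hD : D ≠ ⊤ := (isCompact_unitCube d).isBounded.ediam_ne_top
  have hL : L < 1 := ENNReal.ofReal_lt_one.2 <|
    Real.rpow_lt_one_of_one_lt_of_neg (by exact_mod_cast hq) (by linarith)
  have hlim : Tendsto (fun n : ℕ => L ^ n * D) atTop (𝓝 0) := by
    simpa using ENNReal.Tendsto.mul_const (b := D)
      (ENNReal.tendsto_pow_atTop_nhds_zero_of_lt_one hL) (Or.inr hD)
  choose C hcover hdiam using fun n => exists_falconerStage_cover d q σ n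
  have hsum : ∀ n, ∑ w, ediam (C n w) ^ (d / σ) ≤ D ^ (d / σ) := fun n => by
    calc ∑ w, ediam (C n w) ^ (d / σ)
        ≤ ∑ _w : Fin n → Fin d → Fin q, (L ^ n * D) ^ (d / σ) := by
          gcongr with w
          exact hdiam n w
      _ = ((q : ℝ≥0∞) ^ d * L ^ (d / σ)) ^ n * D ^ (d / σ) := by
          rw [ENNReal.mul_rpow_of_nonneg _ _ hs, Finset.sum_const, nsmul_eq_mul, ← mul_assoc,
            mul_pow, ← ENNReal.rpow_natCast, ← ENNReal.rpow_mul, mul_comm (n : ℝ),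
            ENNReal.rpow_mul, ENNReal.rpow_natCast]
          simp
      _ = D ^ (d / σ) := by
          rw [pow_mul_ofReal_rpow_neg_rpow_div (by lia) hσ.ne', one_pow, one_mul]
  refine dimH_le_of_hausdorffMeasure_ne_top (d := (d / σ).toNNReal) ?_
  rw [Real.coe_toNNReal _ hs]
  refine ne_top_of_le_ne_top (ENNReal.rpow_ne_top_of_nonneg hs hD) <|
    (Measure.hausdorffMeasure_le_liminf_sum (d / σ) _ _ hlim C (.of_forall hdiam)
      (eventually_atTop.2 ⟨1, fun n hn => ?_⟩)).trans
      (liminf_le_of_frequently_le' (.of_forall hsum))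
  obtain ⟨n, rfl⟩ := Nat.exists_eq_add_of_le' hn
  exact (iInter_subset _ n).trans (hcover (n + 1))

theorem abs_ofDigits_sub_le_rpow {q : ℕ} {σ : ℝ} (hq : 1 < q) (hσ : 1 < σ) (a b : ℕ → Fin q) :
    |Real.ofDigits a - Real.ofDigits b| ≤ (1 / q - (q : ℝ) ^ (-σ)) ^ (-σ⁻¹) *
      |cantorSum ((q : ℝ) ^ (-σ)) a - cantorSum ((q : ℝ) ^ (-σ)) b| ^ σ⁻¹ := by
  have hl := rpow_neg_lt_one_div hq hσ
  have hgap : 0 < 1 / q - (q : ℝ) ^ (-σ) := sub_pos.2 hl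
  rcases eq_or_ne a b with rfl | hab
  · simp only [sub_self, abs_zero]
    positivity
  set n := PiNat.firstDiff a b
  have hagree : ∀ k < n, a k = b k := fun k hk => PiNat.apply_eq_of_lt_firstDiff hk
  have hsep : (1 / q - (q : ℝ) ^ (-σ)) * ((q : ℝ) ^ (-σ)) ^ n ≤ _ :=
    le_abs_cantorSum_sub (by positivity) hl n a b hagree (PiNat.apply_firstDiff_ne hab)
  have hpow : (((q : ℝ) ^ (-σ)) ^ n) ^ σ⁻¹ = ((q : ℝ) ^ n)⁻¹ := by
    rw [← Real.rpow_natCast, ← Real.rpow_natCast, ← Real.rpow_mul (by positivity),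
      ← Real.rpow_mul (by positivity), ← Real.rpow_neg (by positivity)]
    congr 1
    field_simp
  calc |Real.ofDigits a - Real.ofDigits b| ≤ ((q : ℝ) ^ n)⁻¹ :=
        Real.abs_ofDigits_sub_ofDigits_le hagree
    _ = (1 / q - (q : ℝ) ^ (-σ)) ^ (-σ⁻¹) *
          ((1 / q - (q : ℝ) ^ (-σ)) * ((q : ℝ) ^ (-σ)) ^ n) ^ σ⁻¹ := by
        rw [Real.mul_rpow hgap.le (by positivity), ← mul_assoc, ← Real.rpow_add hgap,
          neg_add_cancel, Real.rpow_zero, one_mul, hpow]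
    _ ≤ _ := by gcongr

theorem le_dimH_falconerSet {d q : ℕ} {σ : ℝ} (hq : 1 < q) (hσ : 1 < σ) :
    ENNReal.ofReal (d / σ) ≤ dimH (falconerSet d q σ) := by
  let f : (Fin d → ℕ → Fin q) → EuclideanSpace ℝ (Fin d) := fun a =>
    WithLp.toLp 2 fun i => cantorSum ((q : ℝ) ^ (-σ)) (a i)
  let g : (Fin d → ℕ → Fin q) → Fin d → ℝ := fun a i => Real.ofDigits (a i)
  set c : ℝ := (1 / q - (q : ℝ) ^ (-σ)) ^ (-σ⁻¹)
  have hc : 0 ≤ c := Real.rpow_nonneg (sub_pos.2 (rpow_neg_lt_one_div hq hσ)).le _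
  have hr : 0 < σ⁻¹.toNNReal := Real.toNNReal_pos.2 (by positivity)
  have hholder : ∀ a b, edist (g a) (g b) ≤
      c.toNNReal * edist (f a) (f b) ^ (σ⁻¹.toNNReal : ℝ) := fun a b => by
    refine edist_pi_le_iff.2 fun i => ?_
    have hcoord : |f a i - f b i| ≤ dist (f a) (f b) := by
      rw [dist_eq_norm]
      exact PiLp.norm_apply_le (f a - f b) i
    rw [edist_dist, edist_dist, Real.dist_eq, Real.coe_toNNReal _ (by positivity),
      ENNReal.ofReal_rpow_of_nonneg dist_nonneg (by positivity), ← ENNReal.ofReal,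
      ← ENNReal.ofReal_mul hc]
    refine ENNReal.ofReal_le_ofReal ((abs_ofDigits_sub_le_rpow hq hσ (a i) (b i)).trans ?_)
    gcongr
  have hsurj : Icc 0 1 ⊆ range g := fun y hy => by
    choose a ha using fun i => Real.ofDigits_SurjOn hq (⟨hy.1 i, hy.2 i⟩ : y i ∈ Icc (0 : ℝ) 1)
    exact ⟨a, funext fun i => (ha i).2⟩
  have hsub : range f ⊆ falconerSet d q σ :=
    range_subset_iff.2 fun a => cantorSum_mem_falconerSet hq hσ a
  have hdim : (d : ℝ≥0∞) ≤ dimH (falconerSet d q σ) / σ⁻¹.toNNReal :=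
    calc (d : ℝ≥0∞) = dimH (Icc (0 : Fin d → ℝ) 1) := (dimH_Icc_zero_one_pi d).symm
      _ ≤ dimH (range g) := dimH_mono hsurj
      _ ≤ dimH (range f) / σ⁻¹.toNNReal := dimH_range_le_of_edist_le hr hholder
      _ ≤ _ := by gcongr
  rw [ENNReal.le_div_iff_mul_le (Or.inl (by exact_mod_cast hr.ne')) (Or.inl ENNReal.coe_ne_top),
    ← ENNReal.ofReal, ← ENNReal.ofReal_natCast d, ← ENNReal.ofReal_mul (by positivity)] at hdim
  rwa [div_eq_mul_inv]

theorem dimH_falconerSet {d q : ℕ} {σ : ℝ} (hq : 1 < q) (hσ : 1 < σ) :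
    dimH (falconerSet d q σ) = ENNReal.ofReal (d / σ) :=
  (dimH_falconerSet_le hq (by linarith)).antisymm (le_dimH_falconerSet hq hσ)

/-! ### Total disconnectedness of Falconer sets -/

/-- The `i`-th coordinate of `y`, viewed as a point of `ℝ¹`. It maps the Falconer set in `ℝᵈ` into
the one-dimensional one. -/
def coordPoint {d : ℕ} (i : Fin d) (y : EuclideanSpace ℝ (Fin d)) : EuclideanSpace ℝ (Fin 1) :=
  WithLp.toLp 2 fun _ => y i

theorem coordPoint_image_affineCopy {d : ℕ} (i : Fin d) (x : EuclideanSpace ℝ (Fin d)) (u : ℝ)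
    (A : Set (EuclideanSpace ℝ (Fin d))) :
    coordPoint i '' affineCopy x u A = affineCopy (coordPoint i x) u (coordPoint i '' A) := by
  simp only [affineCopy, image_image]
  rfl

theorem coordPoint_image_falconerStage_subset {d q : ℕ} {σ : ℝ} (i : Fin d) (n : ℕ) :
    coordPoint i '' falconerStage d q σ n ⊆ falconerStage 1 q σ n := by
  induction n with
  | zero =>
    rintro _ ⟨y, hy, rfl⟩ _
    exact hy i
  | succ n ih =>
    simp only [falconerStage, image_iUnion, coordPoint_image_affineCopy]
    exact iUnion_subset fun p =>
      (image_mono ih).trans (subset_iUnion_of_subset (fun _ => p i) subset_rfl)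

theorem coordPoint_image_falconerSet_subset {d q : ℕ} {σ : ℝ} (i : Fin d) :
    coordPoint i '' falconerSet d q σ ⊆ falconerSet 1 q σ :=
  (image_iInter_subset _ _).trans (iInter_mono fun _ => coordPoint_image_falconerStage_subset i _)

theorem isTotallyDisconnected_iUnion_affineCopy {ι : Type*} [Countable ι] [Nonempty ι] {d q : ℕ}
    {σ : ℝ} (hq : 1 < q) (hσ : 1 < σ) (x : ι → EuclideanSpace ℝ (Fin d)) {u : ι → ℝ}
    (hu : ∀ k, u k ≠ 0) : IsTotallyDisconnected (⋃ k, affineCopy (x k) (u k) (falconerSet d q σ)) :=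
  isTotallyDisconnected_of_forall_image (f := coordPoint) (fun i => by unfold coordPoint; fun_prop)
    (fun y z h => by
      ext i
      exact congrArg (fun v : EuclideanSpace ℝ (Fin 1) => v 0) (h i))
    fun i => isTotallyDisconnected_of_dimH_lt_one <| calc
      dimH (coordPoint i '' ⋃ k, affineCopy (x k) (u k) (falconerSet d q σ))
        ≤ dimH (⋃ k, affineCopy (coordPoint i (x k)) (u k) (falconerSet 1 q σ)) := by
          simp only [image_iUnion, coordPoint_image_affineCopy]
          exact dimH_mono (iUnion_mono fun k => image_mono (coordPoint_image_falconerSet_subset i))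
      _ = ENNReal.ofReal (1 / σ) := by
          rw [dimH_iUnion_affineCopy _ hu, dimH_falconerSet hq hσ, Nat.cast_one]
      _ < 1 := ENNReal.ofReal_lt_one.2 ((div_lt_one (by linarith)).2 hσ)

/-! ### Signed digit sums and distances in Falconer sets -/

/-- The sums `∑_{k < n} (b k / q) l ^ k` with signed digits `|b k| < q`. They are the coordinate
differences of the points of a Falconer set whose digits agree from the `n`-th one on. -/
def signedDigitSums (q : ℕ) (l : ℝ) (n : ℕ) : Set ℝ :=
  {x | ∃ b : ℕ → ℤ, (∀ k, |b k| < q) ∧ x = ∑ k ∈ Finset.range n, b k / q * l ^ k}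

section SignedDigitSums

variable {q n : ℕ} {l x : ℝ}

theorem zero_mem_signedDigitSums (hq : 0 < q) (l : ℝ) (n : ℕ) : 0 ∈ signedDigitSums q l n :=
  ⟨0, fun _ => by simpa using hq, by simp⟩

theorem add_digit_mem_signedDigitSums (hx : x ∈ signedDigitSums q l n) {z : ℤ} (hz : |z| < q) :
    x + z / q * l ^ n ∈ signedDigitSums q l (n + 1) := by
  obtain ⟨b, hb, rfl⟩ := hx
  refine ⟨Function.update b n z, fun k => ?_, ?_⟩
  · rcases eq_or_ne k n with rfl | hk
    · simpa using hz
    · simpa [hk] using hb k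
  · rw [Finset.sum_range_succ, Function.update_self]
    congr 1
    refine Finset.sum_congr rfl fun k hk => ?_
    rw [Function.update_of_ne (Finset.mem_range.1 hk).ne]

theorem exists_digit_add_mul_eq (hx : x ∈ signedDigitSums q l (n + 1)) :
    ∃ z : ℤ, |z| < q ∧ ∃ y ∈ signedDigitSums q l n, x = z / q + l * y := by
  obtain ⟨b, hb, rfl⟩ := hx
  refine ⟨b 0, hb 0, _, ⟨fun k => b (k + 1), fun k => hb _, rfl⟩, ?_⟩
  rw [Finset.sum_range_succ', Finset.mul_sum, add_comm, pow_zero, mul_one]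
  simp only [pow_succ', mul_left_comm]

theorem mul_one_div_mem_signedDigitSums (hq : 0 < q) (l : ℝ) {b : ℤ} (hb : 0 ≤ b)
    (h : b * (1 / (q : ℝ)) < 1) : b * (1 / (q : ℝ)) ∈ signedDigitSums q l 1 := by
  have hbq : |b| < q := by
    rw [mul_one_div, div_lt_one (by exact_mod_cast hq)] at h
    rw [abs_of_nonneg hb]
    exact_mod_cast h
  simpa [div_eq_mul_inv] using
    add_digit_mem_signedDigitSums (zero_mem_signedDigitSums hq l 0) hbq

end SignedDigitSums

theorem exists_fin_sub_eq {q : ℕ} {z : ℤ} (hz : |z| < q) :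
    ∃ a b : Fin q, ((a : ℕ) : ℝ) - (b : ℕ) = z := by
  have := abs_lt.1 hz
  refine ⟨⟨z.toNat, by lia⟩, ⟨(-z).toNat, by lia⟩, ?_⟩
  exact_mod_cast (by lia : (z.toNat : ℤ) - (-z).toNat = z)

section Distances

variable {d q : ℕ} {σ t : ℝ} (hq : 1 < q) (hσ : 1 < σ)
include hq hσ

theorem exists_sub_eq_of_forall_mem_signedDigitSums {n : ℕ} {v : EuclideanSpace ℝ (Fin d)}
    (hv : ∀ i, v i ∈ signedDigitSums q ((q : ℝ) ^ (-σ)) n) :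
    ∃ x ∈ falconerSet d q σ, ∃ y ∈ falconerSet d q σ, x - y = v := by
  induction n generalizing v with
  | zero =>
    obtain ⟨x, hx⟩ := falconerSet_nonempty (d := d) hq hσ
    refine ⟨x, hx, x, hx, ?_⟩
    ext i
    obtain ⟨b, -, hb⟩ := hv i
    simpa using hb.symm
  | succ n ih =>
    choose z hz w hw hvz using fun i => exists_digit_add_mul_eq (hv i)
    choose a b hab using fun i => exists_fin_sub_eq (hz i)
    obtain ⟨x, hx, y, hy, hxy⟩ := ih (v := WithLp.toLp 2 w) hw
    refine ⟨_, affineCopy_falconerSet_subset hq hσ a (mem_image_of_mem _ hx),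
      _, affineCopy_falconerSet_subset hq hσ b (mem_image_of_mem _ hy), ?_⟩
    ext i
    have hxyi : x i - y i = w i := congrArg (fun v : EuclideanSpace ℝ (Fin d) => v i) hxy
    simp only [gridPoint, PiLp.sub_apply, PiLp.add_apply, PiLp.smul_apply, smul_eq_mul]
    rw [hvz, ← hab, ← hxyi]
    ring

theorem sqrt_sq_add_sq_mem_distanceSet (hd : 2 ≤ d) {n : ℕ} {X Y : ℝ}
    (hX : X ∈ signedDigitSums q ((q : ℝ) ^ (-σ)) n)
    (hY : Y ∈ signedDigitSums q ((q : ℝ) ^ (-σ)) n) :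
    √(X ^ 2 + Y ^ 2) ∈ distanceSet (falconerSet d q σ) := by
  obtain ⟨e, rfl⟩ := Nat.exists_eq_add_of_le' hd
  let v : EuclideanSpace ℝ (Fin (e + 2)) := WithLp.toLp 2 (Fin.cons X (Fin.cons Y 0))
  have hv : ∀ i, v i ∈ signedDigitSums q ((q : ℝ) ^ (-σ)) n :=
    Fin.cases hX (Fin.cases hY fun _ => zero_mem_signedDigitSums (by lia) _ _)
  obtain ⟨x, hx, y, hy, hxy⟩ := exists_sub_eq_of_forall_mem_signedDigitSums hq hσ hv
  refine ⟨x, hx, y, hy, ?_⟩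
  rw [dist_eq_norm, hxy, EuclideanSpace.norm_eq]
  simp [v, Fin.sum_univ_succ]

theorem mem_distanceSet_falconerSet_of_approx (hd : 2 ≤ d) (ht : 0 ≤ t) {C : ℝ}
    (h : ∀ n, ∃ N, ∃ X ∈ signedDigitSums q ((q : ℝ) ^ (-σ)) N,
      ∃ Y ∈ signedDigitSums q ((q : ℝ) ^ (-σ)) N,
        |X ^ 2 + Y ^ 2 - t ^ 2| ≤ C * ((q : ℝ) ^ (-σ)) ^ n) :
    t ∈ distanceSet (falconerSet d q σ) := by
  refine mem_distanceSet_of_sq_approx (isCompact_falconerSet d q σ) ht fun ε hε => ?_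
  have hlim : Tendsto (fun n : ℕ => C * ((q : ℝ) ^ (-σ)) ^ n) atTop (𝓝 0) := by
    simpa using (tendsto_pow_atTop_nhds_zero_of_lt_one (by positivity)
      (lt_one_of_lt_one_div (rpow_neg_lt_one_div hq hσ))).const_mul C
  obtain ⟨n, hn⟩ := (hlim.eventually_lt_const hε).exists
  obtain ⟨N, X, hX, Y, hY, hXY⟩ := h n
  refine ⟨_, sqrt_sq_add_sq_mem_distanceSet hq hσ hd hX hY, ?_⟩
  rw [Real.sq_sqrt (by positivity)]
  exact hXY.trans_lt hn

theorem pow_mul_mem_distanceSet_falconerSet (ht : t ∈ distanceSet (falconerSet d q σ)) (n : ℕ) :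
    ((q : ℝ) ^ (-σ)) ^ n * t ∈ distanceSet (falconerSet d q σ) := by
  induction n with
  | zero => simpa using ht
  | succ n ih =>
    rw [pow_succ', mul_assoc]
    exact distanceSet_mono (affineCopy_falconerSet_subset hq hσ fun _ => ⟨0, by lia⟩)
      (mul_mem_distanceSet_affineCopy ih (by positivity) _)

end Distances

/-! ### Approximation by signed digit sums -/

theorem exists_signedDigitSums_abs_sub_le {q : ℕ} {l t : ℝ} (hq : 2 ≤ q) (hl : 0 < l)
    (hlq : 3 / 4 ≤ l * q) (ht : |t| ≤ 2 / 3) (n : ℕ) :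
    ∃ X ∈ signedDigitSums q l n, |t - X| ≤ 2 / 3 * l ^ n := by
  have hq' : (2 : ℝ) ≤ q := by exact_mod_cast hq
  induction n with
  | zero => exact ⟨0, zero_mem_signedDigitSums (by lia) _ _, by simpa using ht⟩
  | succ n ih =>
    obtain ⟨X, hX, hXt⟩ := ih
    have hln : 0 < l ^ n := by positivity
    set τ := (t - X) / l ^ n with hτ
    have hτ_le : |τ| ≤ 2 / 3 := by rwa [hτ, abs_div, abs_of_pos hln, div_le_iff₀ hln]
    have hround := abs_sub_round (q * τ)
    have hz : |round (q * τ)| < (q : ℤ) := by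
      have hτq : |q * τ| ≤ q * (2 / 3) := by
        rw [abs_mul, Nat.abs_cast]
        gcongr
      have : |(round (q * τ) : ℝ)| < q := by
        rw [abs_le] at hτq hround
        exact abs_lt.2 ⟨by linarith, by linarith⟩
      exact_mod_cast this
    refine ⟨_, add_digit_mem_signedDigitSums hX hz, ?_⟩
    have hrescale : t - (X + round (q * τ) / q * l ^ n) =
        (q * τ - round (q * τ)) / q * l ^ n := by
      rw [hτ]
      field_simp
      ring
    have hstep : |(q * τ - round (q * τ)) / q| ≤ 2 / 3 * l := by
      rw [abs_div, Nat.abs_cast, div_le_iff₀ (by linarith)]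
      linarith
    rw [hrescale, abs_mul, abs_of_pos hln, pow_succ', ← mul_assoc]
    gcongr

theorem exists_greedy_step {x μ s : ℝ} (hx : 0 ≤ x) (hμ : 0 < μ) (hs : x ^ 2 ≤ s) :
    ∃ z : ℤ, 0 ≤ z ∧ (x + z * μ) ^ 2 ≤ s ∧ s < (x + z * μ + μ) ^ 2 := by
  have hs0 : 0 ≤ s := (sq_nonneg x).trans hs
  have hxs : 0 ≤ √s - x := sub_nonneg.2 (Real.le_sqrt_of_sq_le hs)
  have hz : 0 ≤ ⌊(√s - x) / μ⌋ := Int.floor_nonneg.2 (by positivity)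
  have : (0 : ℝ) ≤ ⌊(√s - x) / μ⌋ := by exact_mod_cast hz
  have hfloor := (le_div_iff₀ hμ).1 (Int.floor_le ((√s - x) / μ))
  have hlt_floor := (div_lt_iff₀ hμ).1 (Int.lt_floor_add_one ((√s - x) / μ))
  refine ⟨_, hz, (Real.le_sqrt (by positivity) hs0).1 (by linarith), ?_⟩
  exact (Real.sqrt_lt' (by positivity)).1 (by linarith)

/-- Raising `X` greedily while the amount `c ≥ Y²` is reserved for `Y`, and then raising `Y`. -/
theorem exists_greedy_pair {X Y c t μ : ℝ} (hX : 0 ≤ X) (hY : 0 ≤ Y) (hYc : Y ^ 2 ≤ c)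
    (hc : X ^ 2 + c ≤ t ^ 2) (ht0 : 0 ≤ t) (ht : t ≤ 1 / 2) (hμ : 0 < μ) (hμ1 : μ ≤ 1) :
    ∃ z w : ℤ, 0 ≤ z ∧ 0 ≤ w ∧ (X + z * μ) ^ 2 + c ≤ t ^ 2 ∧
      t ^ 2 ≤ (X + z * μ) ^ 2 + c + 2 * μ ∧ (X + z * μ) ^ 2 + (Y + w * μ) ^ 2 ≤ t ^ 2 ∧
      t ^ 2 < (X + z * μ) ^ 2 + (Y + w * μ + μ) ^ 2 := by
  obtain ⟨z, hz, hz_le, hz_lt⟩ := exists_greedy_step hX hμ (le_sub_iff_add_le.2 hc)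
  have : 0 ≤ z * μ := mul_nonneg (by exact_mod_cast hz) hμ.le
  obtain ⟨w, hw, hw_le, hw_lt⟩ :=
    exists_greedy_step (s := t ^ 2 - (X + z * μ) ^ 2) hY hμ (by linarith)
  refine ⟨z, w, hz, hw, by linarith, ?_, by linarith, by linarith⟩
  have hXt : X + z * μ ≤ t := abs_le_of_sq_le_sq' (by linarith [sq_nonneg Y]) ht0 |>.2
  have : (X + z * μ) * μ ≤ 1 / 2 * μ := by
    gcongr
    linarith
  have : μ ^ 2 ≤ μ := pow_le_of_le_one hμ.le hμ1 two_ne_zero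
  linarith

/-- The invariant of the greedy approximation of `t ^ 2` by `X ^ 2 + Y ^ 2` with `X` and `Y` signed
digit sums of length `n`: the lower bounds on `X` and `Y` make the next digits smaller than `q`, and
the upper bound `Y ≤ 2 η`, with `η = l q / 40`, makes the residual decay like `l ^ n`. -/
structure GreedyApprox (q : ℕ) (l η t : ℝ) (n : ℕ) (X Y : ℝ) : Prop where
  one_div_nine_le : 1 / 9 ≤ X
  two_div_le : 2 / q ≤ Y
  sq_sub_sq_le : t ^ 2 - X ^ 2 ≤ 4 * η ^ 2
  sq_add_sq_le : X ^ 2 + Y ^ 2 ≤ t ^ 2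
  le_sq_add_sq_add : t ^ 2 ≤ X ^ 2 + Y ^ 2 + l ^ n / 8

section Greedy

variable {q n : ℕ} {l η t X Y : ℝ} (hη0 : 0 < η) (hη1 : η ≤ 1 / 40) (hq : 1 / q ≤ η ^ 2)
  (hq0 : 0 < q) (hlq : l * q = 40 * η)

include hη0 hη1 hq0 hlq

theorem mem_Ioc_of_mul_eq : l ∈ Ioc 0 1 := by
  have hq1 : (1 : ℝ) ≤ q := by exact_mod_cast hq0
  have hl0 : 0 < l := pos_of_mul_pos_left (by linarith) (by linarith : (0 : ℝ) ≤ q)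
  exact ⟨hl0, (le_mul_of_one_le_right hl0.le hq1).trans (by linarith)⟩

include hq

theorem greedyApprox_succ_of_lt (hX : 1 / 9 ≤ X) (hY : 2 / q ≤ Y)
    (hsub : t ^ 2 - X ^ 2 ≤ 4 * η ^ 2) (hle : X ^ 2 + Y ^ 2 ≤ t ^ 2)
    (hlt : t ^ 2 < X ^ 2 + (Y + 1 / q * l ^ n) ^ 2) : GreedyApprox q l η t (n + 1) X Y := by
  obtain ⟨hl0, hl1⟩ := mem_Ioc_of_mul_eq hη0 hη1 hq0 hlq
  refine ⟨hX, hY, hsub, hle, ?_⟩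
  set μ := 1 / q * l ^ n with hμ
  have : 0 < μ := by positivity
  have hY_le : Y ≤ 2 * η := abs_le_of_sq_le_sq' (by linarith) (by linarith) |>.2
  have hμ_le : μ ≤ η := by
    have : μ ≤ 1 / q := mul_le_of_le_one_right (by positivity) (pow_le_one₀ hl0.le hl1)
    nlinarith
  have hμη : 5 * η * μ = l ^ (n + 1) / 8 := by
    rw [hμ, pow_succ]
    field_simp
    linear_combination -hlq
  have : Y * μ ≤ 2 * η * μ := by gcongr
  have : μ * μ ≤ η * μ := by gcongr
  linarith

theorem exists_greedyApprox_one (ht0 : 1 / 8 ≤ t) (ht1 : t ≤ 1 / 2) :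
    ∃ X ∈ signedDigitSums q l 1, ∃ Y ∈ signedDigitSums q l 1, GreedyApprox q l η t 1 X Y := by
  have hμ0 : (0 : ℝ) < 1 / q := by positivity
  have hη2 : 40 * η ^ 2 ≤ η := by nlinarith
  have ht2 : (1 / 8) ^ 2 ≤ t ^ 2 := by gcongr
  obtain ⟨z, w, hz, hw, hsub, hsub', hle, hlt⟩ :=
    exists_greedy_pair (X := 0) (Y := 0) (c := η ^ 2) (t := t) le_rfl le_rfl
      (by linarith [sq_nonneg η]) (by linarith) (by linarith) ht1 hμ0 (by linarith)
  simp only [zero_add] at hsub hsub' hle hlt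
  have hX0 : 0 ≤ z * (1 / (q : ℝ)) := mul_nonneg (by exact_mod_cast hz) hμ0.le
  have hY0 : 0 ≤ w * (1 / (q : ℝ)) := mul_nonneg (by exact_mod_cast hw) hμ0.le
  have hXt := abs_le_of_sq_le_sq' (by linarith [sq_nonneg η] : (z * (1 / (q : ℝ))) ^ 2 ≤ t ^ 2)
    (by linarith)
  have hYt := abs_le_of_sq_le_sq'
    (by linarith [sq_nonneg (z * (1 / (q : ℝ)))] : (w * (1 / (q : ℝ))) ^ 2 ≤ t ^ 2) (by linarith)
  have hX_ge : 1 / 9 ≤ z * (1 / (q : ℝ)) := abs_le_of_sq_le_sq' (by linarith) hX0 |>.2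
  have hY_ge : 2 / q ≤ w * (1 / (q : ℝ)) := by
    have hη_le : η ≤ w * (1 / (q : ℝ)) + 1 / q :=
      abs_le_of_sq_le_sq' (by linarith) (by linarith) |>.2
    rw [← mul_one_div]
    linarith
  exact ⟨_, mul_one_div_mem_signedDigitSums hq0 l hz (by linarith [hXt.2]),
    _, mul_one_div_mem_signedDigitSums hq0 l hw (by linarith [hYt.2]),
    greedyApprox_succ_of_lt hη0 hη1 hq hq0 hlq hX_ge hY_ge (by linarith) hle (by simpa using hlt)⟩

theorem GreedyApprox.exists_succ (h : GreedyApprox q l η t n X Y) (ht0 : 0 ≤ t) (ht1 : t ≤ 1 / 2) :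
    ∃ z w : ℤ, |z| < q ∧ |w| < q ∧
      GreedyApprox q l η t (n + 1) (X + z / q * l ^ n) (Y + w / q * l ^ n) := by
  obtain ⟨hl0, hl1⟩ := mem_Ioc_of_mul_eq hη0 hη1 hq0 hlq
  have hq1 : (1 : ℝ) ≤ q := by exact_mod_cast hq0
  obtain ⟨hX, hY, hsub, hle, hres⟩ := h
  have hY0 : 0 < Y := lt_of_lt_of_le (by positivity) hY
  set μ : ℝ := 1 / q * l ^ n with hμ
  have hqμ : q * μ = l ^ n := by
    rw [hμ]
    field_simp
  have hμ0 : 0 < μ := by positivity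
  have hμ1 : μ ≤ 1 := by
    have : l ^ n ≤ 1 := pow_le_one₀ hl0.le hl1
    nlinarith
  obtain ⟨z, w, hz, hw, hsub', hsub'', hle', hlt⟩ :=
    exists_greedy_pair (by linarith) hY0.le le_rfl hle ht0 ht1 hμ0 hμ1
  have hzμ : 0 ≤ z * μ := mul_nonneg (by exact_mod_cast hz) hμ0.le
  have hwμ : 0 ≤ w * μ := mul_nonneg (by exact_mod_cast hw) hμ0.le
  have hX_sq : X ^ 2 ≤ (X + z * μ) ^ 2 := by
    gcongr
    linarith
  have hz_lt : z * μ < q * μ := by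
    have : 1 / 9 * (z * μ) ≤ X * (z * μ) := by gcongr
    linarith [sq_nonneg (z * μ), (by positivity : 0 < l ^ n)]
  have hw_lt : (w : ℝ) < q := by
    have hYw : Y * w ≤ 1 := by
      refine le_of_mul_le_mul_right ?_ hμ0
      linarith [sq_nonneg (w * μ)]
    rw [div_le_iff₀ (by linarith)] at hY
    exact lt_of_mul_lt_mul_left (by linarith : Y * w < Y * q) hY0.le
  refine ⟨z, w, ?_, ?_, ?_⟩
  · rw [abs_of_nonneg hz]
    exact_mod_cast lt_of_mul_lt_mul_right hz_lt hμ0.le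
  · rw [abs_of_nonneg hw]
    exact_mod_cast hw_lt
  · have hscale : ∀ b : ℤ, b / q * l ^ n = b * μ := fun b => by rw [hμ]; ring
    rw [hscale, hscale]
    exact greedyApprox_succ_of_lt hη0 hη1 hq hq0 hlq (by linarith) (by linarith) (by linarith)
      hle' hlt

theorem exists_greedyApprox (ht0 : 1 / 8 ≤ t) (ht1 : t ≤ 1 / 2) (n : ℕ) :
    ∃ X ∈ signedDigitSums q l (n + 1), ∃ Y ∈ signedDigitSums q l (n + 1),
      GreedyApprox q l η t (n + 1) X Y := by
  induction n with
  | zero => exact exists_greedyApprox_one hη0 hη1 hq hq0 hlq ht0 ht1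
  | succ n ih =>
    obtain ⟨X, hX, Y, hY, h⟩ := ih
    obtain ⟨z, w, hz, hw, hzw⟩ := h.exists_succ hη0 hη1 hq hq0 hlq (by linarith) ht1
    exact ⟨_, add_digit_mem_signedDigitSums hX hz, _, add_digit_mem_signedDigitSums hY hw, hzw⟩

end Greedy

/-! ### The Steinhaus property -/

theorem le_mul_or_le_mul_sq_of_le {q : ℕ} {σ : ℝ} (hq : 0 < q) (hσ : σ ≤ 30 / 29) :
    3 / 4 ≤ (q : ℝ) ^ (-σ) * q ∨ 1600 ≤ q * ((q : ℝ) ^ (-σ) * q) ^ 2 := by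
  have hq0 : (0 : ℝ) < q := by exact_mod_cast hq
  have hq1 : (1 : ℝ) ≤ q := by exact_mod_cast hq
  refine or_iff_not_imp_left.2 fun hlt => ?_
  set y := (q : ℝ) ^ (-σ) * q with hy
  have hy0 : 0 < y := by positivity
  have hpow : 1 ≤ y ^ 27 * (q * y ^ 2) :=
    calc (1 : ℝ) ≤ (q : ℝ) ^ (-σ * (29 : ℕ) + (30 : ℕ)) :=
          Real.one_le_rpow hq1 (by norm_num; linarith)
      _ = y ^ 27 * (q * y ^ 2) := by
          rw [Real.rpow_add hq0, Real.rpow_mul hq0.le, Real.rpow_natCast, Real.rpow_natCast, hy]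
          ring
  have hsmall : y ^ 27 ≤ (3 / 4) ^ 27 := by
    gcongr
    exact (not_le.1 hlt).le
  have := hpow.trans (mul_le_mul_of_nonneg_right hsmall (by positivity))
  linarith

section Steinhaus

variable {d q : ℕ} {σ t : ℝ} (hd : 2 ≤ d) (hq : 1 < q) (hσ : 1 < σ)
include hd hq hσ

theorem mem_distanceSet_falconerSet_of_le_mul (hlq : 3 / 4 ≤ (q : ℝ) ^ (-σ) * q) (ht0 : 0 ≤ t)
    (ht : t ≤ 2 / 3) : t ∈ distanceSet (falconerSet d q σ) := by
  set l := (q : ℝ) ^ (-σ)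
  have hl0 : 0 < l := Real.rpow_pos_of_pos (by exact_mod_cast (by lia : 0 < q)) _
  have hl1 : l < 1 := lt_one_of_lt_one_div (rpow_neg_lt_one_div hq hσ)
  refine mem_distanceSet_falconerSet_of_approx hq hσ hd ht0 (C := 2) fun n => ?_
  obtain ⟨X, hX, hXt⟩ :=
    exists_signedDigitSums_abs_sub_le hq hl0 hlq (abs_le.2 ⟨by linarith, ht⟩) n
  refine ⟨n, X, hX, 0, zero_mem_signedDigitSums (by lia) _ _, ?_⟩
  have hln : l ^ n ≤ 1 := pow_le_one₀ hl0.le hl1.le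
  have hadd : |t + X| ≤ 2 := by
    rw [abs_le] at hXt ⊢
    exact ⟨by linarith, by linarith⟩
  calc |X ^ 2 + 0 ^ 2 - t ^ 2| = |t + X| * |t - X| := by
        rw [← abs_mul, abs_sub_comm]
        ring_nf
    _ ≤ 2 * l ^ n := by
        gcongr
        exact hXt.trans (mul_le_of_le_one_left (by positivity) (by norm_num))

theorem mem_distanceSet_falconerSet_of_le_mul_sq
    (hlq : 1600 ≤ q * ((q : ℝ) ^ (-σ) * q) ^ 2) (ht0 : 1 / 8 ≤ t) (ht : t ≤ 1 / 2) :
    t ∈ distanceSet (falconerSet d q σ) := by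
  have hq0 : (0 : ℝ) < q := by exact_mod_cast (by lia : 0 < q)
  set l := (q : ℝ) ^ (-σ)
  have : 0 < l := Real.rpow_pos_of_pos hq0 _
  have hlq1 : l * q < 1 := (lt_div_iff₀ hq0).1 (rpow_neg_lt_one_div hq hσ)
  refine mem_distanceSet_falconerSet_of_approx hq hσ hd (by linarith) (C := l / 8) fun n => ?_
  obtain ⟨X, hX, Y, hY, h⟩ := exists_greedyApprox (l := l) (η := l * q / 40) (by positivity)
    (by linarith) (by rw [div_le_iff₀ hq0]; linarith) (by lia) (by ring) ht0 ht n
  refine ⟨n + 1, X, hX, Y, hY, abs_le.2 ⟨?_, ?_⟩⟩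
  · linarith [h.le_sq_add_sq_add, pow_succ' l n]
  · linarith [h.sq_add_sq_le, (by positivity : 0 ≤ l / 8 * l ^ n)]

theorem Icc_subset_distanceSet_falconerSet (hσ' : σ ≤ 30 / 29) :
    Icc (1 / 8) (1 / 2) ⊆ distanceSet (falconerSet d q σ) := fun t ⟨ht0, ht1⟩ => by
  rcases le_mul_or_le_mul_sq_of_le (q := q) (by lia) hσ' with h | h
  · exact mem_distanceSet_falconerSet_of_le_mul hd hq hσ h (by linarith) (by linarith)
  · exact mem_distanceSet_falconerSet_of_le_mul_sq hd hq hσ h ht0 ht1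

end Steinhaus

theorem exists_eq_pow_mul_pow_mul {ρ l x : ℝ} {m : ℕ} (hρ0 : 0 < ρ) (hρ1 : ρ < 1)
    (hρl : ρ ^ (m + 1) ≤ l) (hl : l < 1) (hx0 : 0 < x) (hx1 : x ≤ 1) :
    ∃ n, ∃ k < m + 1, ∃ τ ∈ Icc ρ 1, x = ρ ^ k * (l ^ n * τ) := by
  have hl0 : 0 < l := (pow_pos hρ0 _).trans_le hρl
  obtain ⟨n, hn_lt, hn_le⟩ := exists_nat_pow_near_of_lt_one hx0 hx1 hl0 hl
  have hln : 0 < l ^ n := by positivity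
  have hlx : l < x / l ^ n := by rwa [lt_div_iff₀ hln, ← pow_succ']
  obtain ⟨k, hk_lt, hk_le⟩ := exists_nat_pow_near_of_lt_one (hl0.trans hlx)
    ((div_le_one hln).2 hn_le) hρ0 hρ1
  have hρk : 0 < ρ ^ k := by positivity
  refine ⟨n, k, ?_, x / l ^ n / ρ ^ k, ⟨?_, (div_le_one hρk).2 hk_le⟩, by field_simp⟩
  · by_contra! hmk
    exact (hlx.trans_le (hk_le.trans (pow_le_pow_of_le_one hρ0.le hρ1.le hmk))).not_ge hρl
  · rw [le_div_iff₀ hρk, ← pow_succ']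
    exact hk_lt.le

theorem hasSteinhausProperty_iUnion_affineCopy {d q m : ℕ} {σ : ℝ} (hd : 2 ≤ d) (hq : 1 < q)
    (hσ : 1 < σ) (hσ' : σ ≤ 30 / 29) (hm : (q : ℝ) ^ σ ≤ 4 ^ (m + 1))
    (x : Fin (m + 1) → EuclideanSpace ℝ (Fin d)) :
    HasSteinhausProperty (⋃ k, affineCopy (x k) ((1 / 4) ^ (k : ℕ)) (falconerSet d q σ)) := by
  have hq0 : (0 : ℝ) < q := by exact_mod_cast (by lia : 0 < q)
  have hl1 := lt_one_of_lt_one_div (rpow_neg_lt_one_div hq hσ)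
  have hml : (1 / 4 : ℝ) ^ (m + 1) ≤ (q : ℝ) ^ (-σ) := by
    rw [Real.rpow_neg hq0.le, one_div, inv_pow]
    gcongr
  have hscale : ∀ (k : Fin (m + 1)) {t : ℝ}, t ∈ distanceSet (falconerSet d q σ) →
      (1 / 4) ^ (k : ℕ) * t ∈
        distanceSet (⋃ k, affineCopy (x k) ((1 / 4) ^ (k : ℕ)) (falconerSet d q σ)) :=
    fun k t ht => distanceSet_mono (subset_iUnion_of_subset k subset_rfl)
      (mul_mem_distanceSet_affineCopy ht (by positivity) (x k))
  refine ⟨1 / 2, by norm_num, fun t ht => ?_⟩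
  rcases ht.1.eq_or_lt with rfl | ht0
  · obtain ⟨y, hy⟩ := falconerSet_nonempty (d := d) hq hσ
    simpa using hscale 0 ⟨y, hy, y, hy, (dist_self y).symm⟩
  · obtain ⟨n, k, hk, τ, ⟨hτ0, hτ1⟩, hτ⟩ := exists_eq_pow_mul_pow_mul (x := 2 * t) (by norm_num)
      (by norm_num) hml hl1 (by linarith) (by linarith [ht.2])
    have hτmem : τ / 2 ∈ distanceSet (falconerSet d q σ) :=
      Icc_subset_distanceSet_falconerSet hd hq hσ hσ' ⟨by linarith, by linarith⟩
    convert! hscale ⟨k, hk⟩ (pow_mul_mem_distanceSet_falconerSet hq hσ hτmem n) using 1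
    linarith

theorem exists_disjoint_affineCopies {d q m : ℕ} {s : ℝ} (hd : 2 ≤ d) (hq : 1 < q)
    (hs : (d : ℝ) - d / 30 < s) (hsd : s < d) (hm : (q : ℝ) ^ ((d : ℝ) / s) ≤ 4 ^ (m + 1)) :
    ∃ (x : Fin (m + 1) → EuclideanSpace ℝ (Fin d)) (u : Fin (m + 1) → ℝ)
      (K : Set (EuclideanSpace ℝ (Fin d))),
      (∀ k, 0 < u k) ∧
      Pairwise (fun j k =>
        Disjoint (affineCopy (x j) (u j) (falconerSet d q ((d : ℝ) / s)))
          (affineCopy (x k) (u k) (falconerSet d q ((d : ℝ) / s)))) ∧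
      K = ⋃ k, affineCopy (x k) (u k) (falconerSet d q ((d : ℝ) / s)) ∧
      IsCompact K ∧ IsTotallyDisconnected K ∧ dimH K = ENNReal.ofReal s ∧
      HasSteinhausProperty K := by
  have hd0 : (0 : ℝ) < d := by exact_mod_cast (by lia : 0 < d)
  have hs0 : 0 < s := by linarith
  have hσ : 1 < (d : ℝ) / s := (one_lt_div hs0).2 hsd
  have hσ' : (d : ℝ) / s ≤ 30 / 29 := (div_le_iff₀ hs0).2 (by linarith)
  have hu : ∀ k : Fin (m + 1), ((1 / 4) ^ (k : ℕ) : ℝ) ≠ 0 := fun k => by positivity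
  let x : Fin (m + 1) → EuclideanSpace ℝ (Fin d) := fun k => WithLp.toLp 2 fun _ => 2 * (k : ℕ)
  have hx : Pairwise fun j k => 1 < |x j ⟨0, by lia⟩ - x k ⟨0, by lia⟩| := fun j k hjk => by
    have : (j : ℕ) ≠ k := Fin.val_ne_of_ne hjk
    have : 1 < |2 * ((j : ℕ) : ℤ) - 2 * ((k : ℕ) : ℤ)| := by
      rw [lt_abs]
      lia
    change 1 < |2 * ((j : ℕ) : ℝ) - 2 * ((k : ℕ) : ℝ)|
    exact_mod_cast this
  refine ⟨x, fun k => (1 / 4) ^ (k : ℕ), _, fun k => by positivity,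
    pairwise_disjoint_affineCopy (falconerSet_subset_unitCube hq hσ)
      (fun k => ⟨by positivity, pow_le_one₀ (by norm_num) (by norm_num)⟩) _ hx, rfl,
    isCompact_iUnion fun k => isCompact_affineCopy _ _ (isCompact_falconerSet _ _ _),
    isTotallyDisconnected_iUnion_affineCopy hq hσ x hu, ?_,
    hasSteinhausProperty_iUnion_affineCopy hd hq hσ hσ' hm x⟩
  rw [dimH_iUnion_affineCopy x hu, dimH_falconerSet hq hσ, div_div_cancel₀ hd0.ne']

theorem corollary1p7 (d : ℕ) (hd : 2 ≤ d) :
    ∃ ε r : ℝ, 0 < ε ∧ 1 < r ∧ ∀ s : ℝ, (d : ℝ) - ε < s → s < d →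
      (∃ K : Set (EuclideanSpace ℝ (Fin d)),
        IsCompact K ∧ IsTotallyDisconnected K ∧ dimH K = ENNReal.ofReal s ∧
          HasSteinhausProperty K) ∧
      ∀ q m : ℕ, r < (q : ℝ) ^ ((d : ℝ) / s) →
        IsGreatest {k : ℕ | r ^ k < (q : ℝ) ^ ((d : ℝ) / s)} m →
        ∃ (x : Fin (m + 1) → EuclideanSpace ℝ (Fin d)) (u : Fin (m + 1) → ℝ)
          (K : Set (EuclideanSpace ℝ (Fin d))),
          (∀ k, 0 < u k) ∧
          Pairwise (fun j k =>
            Disjoint (affineCopy (x j) (u j) (falconerSet d q ((d : ℝ) / s)))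
              (affineCopy (x k) (u k) (falconerSet d q ((d : ℝ) / s)))) ∧
          K = ⋃ k, affineCopy (x k) (u k) (falconerSet d q ((d : ℝ) / s)) ∧
          IsCompact K ∧ IsTotallyDisconnected K ∧ dimH K = ENNReal.ofReal s ∧
          HasSteinhausProperty K := by
  have : (0 : ℝ) < d := by exact_mod_cast (by lia : 0 < d)
  refine ⟨d / 30, 4, by positivity, by norm_num, fun s hs hsd => ?_⟩
  have hs0 : 0 < s := by linarith
  refine ⟨?_, fun q m hq hm => ?_⟩
  · have hσ : (d : ℝ) / s ≤ 2 := (div_le_iff₀ hs0).2 (by linarith)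
    have h2 : ((2 : ℕ) : ℝ) ^ ((d : ℝ) / s) ≤ 4 ^ (0 + 1) :=
      calc ((2 : ℕ) : ℝ) ^ ((d : ℝ) / s) ≤ (2 : ℕ) ^ (2 : ℝ) :=
            Real.rpow_le_rpow_of_exponent_le (by norm_num) hσ
        _ = 4 ^ (0 + 1) := by norm_num
    obtain ⟨-, -, K, -, -, -, hK⟩ := exists_disjoint_affineCopies hd one_lt_two hs hsd h2
    exact ⟨K, hK⟩
  · have hq1 : 1 < q := by
      by_contra! hq1
      have : (q : ℝ) ^ ((d : ℝ) / s) ≤ 1 :=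
        Real.rpow_le_one q.cast_nonneg (by exact_mod_cast hq1) (by positivity)
      linarith
    have hmax : (q : ℝ) ^ ((d : ℝ) / s) ≤ 4 ^ (m + 1) :=
      not_lt.1 fun h => (Nat.lt_succ_self m).not_ge (hm.2 h)
    exact exists_disjoint_affineCopies hd hq1 hs hsd hmax
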